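/- There is a constant $C>0$ such that the following holds for all real $\nu>0$, all real $k$ with $|k|\ge 1$ and all $\lambda\in\mathbb{R}$. Let $I=(-1,1)$, let $F\in L^2(I)$ be complex valued, and let $w\in H^2(I)$, complex valued with $w(\pm1)=0$, be a solution of the Orr–Sommerfeld resolvent equation $$-\nu(\partial_y^2-k^2)w+ik\big[(1-y^2-\lambda)w+2\varphi\big]=F\quad\text{on } I,$$ where $\varphi\in H^2(I)$ is determined by $(\partial_y^2-k^2)\varphi=w$ on $I$ and $\varphi(\pm1)=0$. Then $$\nu^{\frac12}|k|^{\frac12}\,\|w\|_{L^2(I)}\le C\,\|F\|_{L^2(I)}.$$ In particular, $C$ does not depend on $\nu$, $k$, $\lambda$, $F$ or $w$. -/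

import Mathlib

open MeasureTheory Set
open scoped ContDiff

namespace OrrSommerfeld

/-- Lebesgue measure on the open interval `I = (-1, 1)`. -/
noncomputable def intervalMeasure : Measure ℝ := volume.restrict (Ioo (-1 : ℝ) 1)

/-- Membership in the complex space `L²(I)`. -/
def IsL2 (f : ℝ → ℂ) : Prop := MemLp f 2 intervalMeasure

/-- The norm of `L²(I)` (of a function in `L²(I)`). -/
noncomputable def normL2 (f : ℝ → ℂ) : ℝ := (eLpNorm f 2 intervalMeasure).toReal

/-- Test functions: real-valued elements of `C_c^∞(I)`. -/
def IsTestFunction (ψ : ℝ → ℝ) : Prop :=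
  ContDiff ℝ ∞ ψ ∧ HasCompactSupport ψ ∧ tsupport ψ ⊆ Ioo (-1 : ℝ) 1

/-- `g` is the weak derivative of `f` on `I`; used for `f`, `g` in `L²(I)` only. -/
def IsWeakDeriv (f g : ℝ → ℂ) : Prop :=
  ∀ ψ : ℝ → ℝ, IsTestFunction ψ →
    ∫ y, ((deriv ψ y : ℝ) : ℂ) * f y ∂intervalMeasure = -∫ y, (ψ y : ℂ) * g y ∂intervalMeasure

/-- `f ∈ H²(I)`, with weak derivatives `f₁ = f'` and `f₂ = f''`. -/
structure IsH2With (f f₁ f₂ : ℝ → ℂ) : Prop where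
  memL2 : IsL2 f
  memL2_one : IsL2 f₁
  memL2_two : IsL2 f₂
  weakDeriv_one : IsWeakDeriv f f₁
  weakDeriv_two : IsWeakDeriv f₁ f₂

/-- The boundary condition `f(±1) = 0`: it is imposed on the representative of `f` that is
continuous on `[-1, 1]`. -/
def VanishesAtEnds (f : ℝ → ℂ) : Prop :=
  ∃ u : ℝ → ℂ, ContinuousOn u (Icc (-1 : ℝ) 1) ∧ u =ᵐ[intervalMeasure] f ∧ u (-1) = 0 ∧ u 1 = 0

/-- `φ ∈ H²(I)` is the stream function of `w`: `(∂_y² - k²) φ = w` and `φ(±1) = 0`. -/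
def IsStreamFunction (k : ℝ) (w φ : ℝ → ℂ) : Prop :=
  VanishesAtEnds φ ∧ ∃ φ₁ φ₂ : ℝ → ℂ, IsH2With φ φ₁ φ₂ ∧
    ∀ᵐ y ∂intervalMeasure, φ₂ y - (k : ℂ) ^ 2 * φ y = w y

/-- `w ∈ H²(I)` with `w(±1) = 0` and stream function `φ` solves
`-ν (∂_y² - k²) w + i k [(1 - y² - lam) w + 2 φ] = F`. -/
def IsSolution (ν k lam : ℝ) (F w φ : ℝ → ℂ) : Prop :=
  VanishesAtEnds w ∧ IsStreamFunction k w φ ∧ ∃ w₁ w₂ : ℝ → ℂ, IsH2With w w₁ w₂ ∧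
    ∀ᵐ y ∂intervalMeasure,
      -(ν : ℂ) * (w₂ y - (k : ℂ) ^ 2 * w y) +
        Complex.I * (k : ℂ) * (((1 - y ^ 2 - lam : ℝ) : ℂ) * w y + 2 * φ y) = F y

end OrrSommerfeld

/-! Put `μ = 1 - λ`, `b = y²w - 2φ`, `ε = ν/|k|`, `g = ‖F‖/|k|`. The equation reads `-ν(w'' - k²w) +
ik(μw - b) = F`, and `β = ⟨b, w⟩ = ‖yw‖² + 2(‖φ'‖² + k²‖φ‖²)` is real and nonnegative. Testing with
`w` bounds `‖w'‖` and gives `|β - μ‖w‖²| ≤ g‖w‖`.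

The decisive test function is `yw' + w/2`, the antisymmetric generator of dilations. It eliminates
`μ` and produces the commutator form `‖yw - φ'‖² + k²‖φ‖²`, which is at least `β/28`
(`rayleigh_le_commutator`). Hence `β` is bounded by `F` and by viscous errors in `w'`, `w''` and
`yw'`; testing with `w''` and `b` controls the last two. All of this is integration by parts
(`resolvent_estimate`).

If `g` were much smaller than `√ε ‖w‖`, then, normalizing `‖w‖ = 1`, these bounds would force `β ≤
0.2 max(μ, √ε)` (`bootstrap`). When the maximum is `μ` this contradicts `β ≈ μ`; when it is `√ε`,
the product `‖yw‖ ‖w'‖` is too small for the uncertainty inequality `‖w‖² ≤ 2‖yw‖ ‖w'‖`. -/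

namespace OrrSommerfeld

/-! ### Closing the a priori inequalities: real arithmetic -/

/-- The normalized bootstrap: `s = √ε`, `‖w‖ = 1`. -/
lemma bootstrap_normalized {s μ κ g D S X Y b β : ℝ} (hs : 0 < s)
    (hD : 0 ≤ D) (hS : 0 ≤ S) (hX : 0 ≤ X) (hY : 0 ≤ Y) (hb : 0 ≤ b)
    (hg : g ≤ 1e-6 * s)
    (h1 : s ^ 2 * D ^ 2 ≤ g) (h1' : κ ≤ g) (h2 : 1 ≤ 2 * (Y * D))
    (h3 : s ^ 2 * S ^ 2 ≤ g * S + 2 * (Y * D)) (h4 : s ^ 2 * X ^ 2 ≤ g * b)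
    (h5 : b ^ 2 ≤ μ * β + g * b + 2 * s ^ 2 * X) (h6 : |β - μ| ≤ g)
    (h7 : β ≤ 28 * (g * (X + 1 / 2) + s ^ 2 * S * X + κ * (Y * D)))
    (h8 : Y ^ 2 ≤ β) : False := by
  obtain ⟨h6a, h6b⟩ := abs_le.mp h6
  have hβ : 0 ≤ β := (sq_nonneg Y).trans h8
  -- `ρ = max(μ, s)` is the natural size of `β`; every error below is measured against it.
  obtain ⟨ρ, hρs, hρμ, hρ⟩ : ∃ ρ : ℝ, s ≤ ρ ∧ μ ≤ ρ ∧ (ρ = s ∨ ρ = μ) :=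
    ⟨max μ s, le_max_right _ _, le_max_left _ _, (max_choice μ s).symm⟩
  have hρ0 : 0 < ρ := hs.trans_le hρs
  have hβρ : β ≤ 2 * ρ := by linarith
  have hD2 : s * D ^ 2 ≤ 1e-6 := by
    have : s * (s * D ^ 2) ≤ s * 1e-6 := by linarith
    exact le_of_mul_le_mul_left this hs
  have hX2 : s * X ^ 2 ≤ 1e-6 * b := by
    have : s * (s * X ^ 2) ≤ s * (1e-6 * b) := by
      linarith [mul_le_mul_of_nonneg_right hg hb]
    exact le_of_mul_le_mul_left this hs
  have hsρ : s ^ 2 ≤ ρ ^ 2 := by gcongr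
  have hμβ : μ * β ≤ 2 * ρ ^ 2 := by
    linarith [mul_le_mul_of_nonneg_right hρμ hβ, mul_le_mul_of_nonneg_left hβρ hρ0.le]
  have hbρ : b ≤ 3 * ρ := by
    have e1 : 2 * s ^ 2 * X ≤ s ^ 2 + s * (1e-6 * b) := by
      linarith [mul_le_mul_of_nonneg_left hX2 hs.le, sq_nonneg (s * (X - 1))]
    have e2 : s * b ≤ ρ * b := by gcongr
    have e3 : g * b ≤ 1e-6 * s * b := by gcongr
    by_contra! h
    have e4 : ρ * b ≤ b / 3 * b := by gcongr; linarith
    have e5 : ρ * (3 * ρ) ≤ ρ * b := by gcongr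
    nlinarith [mul_pos hρ0 hρ0]
  have hsρ' : s * ρ ≤ ρ * ρ := by gcongr
  have hX3 : s * X ^ 2 ≤ 3e-6 * ρ := by linarith
  have hsX : s * X ≤ 2 * ρ := by
    apply le_of_sq_le_sq _ (by positivity)
    linarith [mul_le_mul_of_nonneg_left hX3 hs.le, sq_nonneg ρ]
  have hsYD : s * (Y * D) ≤ 2 * ρ := by
    apply le_of_sq_le_sq _ (by positivity)
    have : Y ^ 2 * (s * D ^ 2) ≤ (2 * ρ) * 1e-6 := by
      apply mul_le_mul (h8.trans hβρ) hD2 (by positivity) (by positivity)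
    linarith [mul_le_mul_of_nonneg_left this hs.le, sq_nonneg ρ]
  have hsS : (s * S) ^ 2 ≤ 1 + 4 * (Y * D) := by
    have : g * S ≤ 1e-6 * s * S := by gcongr
    linarith [sq_nonneg (s * S - 1)]
  -- The dominant error in `h7`: `28 * 0.006 = 0.168` is what leaves room for `β ≤ 0.2 ρ`.
  have hSX : s ^ 2 * S * X ≤ 0.006 * ρ := by
    apply le_of_sq_le_sq _ (by positivity)
    have e1 : (s * S) ^ 2 * (s * (s * X ^ 2)) ≤ (1 + 4 * (Y * D)) * (s * (3e-6 * ρ)) := by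
      apply mul_le_mul hsS _ (by positivity) (by positivity)
      gcongr
    have e2 : s * (Y * D) * ρ ≤ 2 * ρ * ρ := by gcongr
    linarith [sq_nonneg ρ]
  have hgX : g * X ≤ 2e-6 * ρ := by linarith [mul_le_mul_of_nonneg_right hg hX]
  have hκ : κ * (Y * D) ≤ 2e-6 * ρ := by
    have : κ * (Y * D) ≤ (1e-6 * s) * (Y * D) := by
      have := h1'.trans hg
      gcongr
    linarith
  have hβ' : β ≤ 0.2 * ρ := by linarith
  -- For `ρ = s` the uncertainty inequality `h2` fails; for `ρ = μ` the lower bound `β ≥ μ - g`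
  -- fails.
  rcases hρ with rfl | rfl
  · have hY2 : Y ^ 2 * (ρ * D ^ 2) ≤ (0.2 * ρ) * 1e-6 :=
      mul_le_mul (h8.trans hβ') hD2 (by positivity) (by positivity)
    have : Y ^ 2 * D ^ 2 ≤ 0.2 * 1e-6 := by
      have : ρ * (Y ^ 2 * D ^ 2) ≤ ρ * (0.2 * 1e-6) := by linarith
      exact le_of_mul_le_mul_left this hs
    have : (1 : ℝ) ^ 2 ≤ (2 * (Y * D)) ^ 2 := by gcongr
    linarith [mul_pow Y D 2, mul_pow 2 (Y * D) 2]
  · linarith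

/-- Homogeneity reduces to `W = 1`: lengths are divided by `W`, quadratic quantities by `W²`. The
letters stand for the norms of `w` (`W`), `w'` (`D`), `w''` (`S`), `yw'` (`X`), `yw` (`Y`) and of
`b`. -/
lemma bootstrap {ε μ k2 g W D S X Y b β : ℝ} (hε : 0 < ε) (hW : 0 ≤ W)
    (hD : 0 ≤ D) (hS : 0 ≤ S) (hX : 0 ≤ X) (hY : 0 ≤ Y) (hb : 0 ≤ b) (hg : 0 ≤ g) (hk : 0 ≤ k2)
    (h1 : ε * (D ^ 2 + k2 * W ^ 2) ≤ g * W) (h2 : W ^ 2 ≤ 2 * (Y * D))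
    (h3 : ε * S ^ 2 ≤ g * S + 2 * (Y * D)) (h4 : ε * X ^ 2 ≤ g * b)
    (h5 : b ^ 2 ≤ μ * β + g * b + 2 * ε * (W * X)) (h6 : |β - μ * W ^ 2| ≤ g * W)
    (h7 : β ≤ 28 * (g * (X + W / 2) + ε * S * X + ε * k2 * (Y * D)))
    (h8 : Y ^ 2 ≤ β) : √ε * W ≤ 1e6 * g := by
  rcases hW.eq_or_lt with rfl | hW
  · rw [mul_zero]; positivity
  by_contra! hlt
  have hs := Real.sqrt_pos.mpr hε
  have hsq := Real.sq_sqrt hε.le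
  have div2 : ∀ {x y : ℝ}, x ≤ y → x / W ^ 2 ≤ y / W ^ 2 := fun h => by gcongr
  refine bootstrap_normalized (s := √ε) (μ := μ) (κ := ε * k2) (g := g / W) (D := D / W)
    (S := S / W) (X := X / W) (Y := Y / W) (b := b / W) (β := β / W ^ 2) hs
    (by positivity) (by positivity) (by positivity) (by positivity) (by positivity)
    ?_ ?_ ?_ ?_ ?_ ?_ ?_ ?_ ?_ ?_
  · rw [div_le_iff₀ hW]; linarith
  · rw [hsq]
    have : ε * D ^ 2 ≤ g * W := by nlinarith [mul_nonneg hε.le (mul_nonneg hk (sq_nonneg W))]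
    convert div2 this using 1 <;> field_simp
  · have : ε * k2 * W ^ 2 ≤ g * W := by nlinarith [mul_nonneg hε.le (sq_nonneg D)]
    convert div2 this using 1 <;> field_simp
  · convert div2 h2 using 1 <;> field_simp
  · rw [hsq]; convert div2 h3 using 1 <;> field_simp
  · rw [hsq]; convert div2 h4 using 1 <;> field_simp
  · rw [hsq]; convert div2 h5 using 1 <;> field_simp
  · have e : β / W ^ 2 - μ = (β - μ * W ^ 2) / W ^ 2 := by field_simp
    rw [e, abs_div, abs_of_pos (by positivity : 0 < W ^ 2)]
    convert div2 h6 using 1; field_simp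
  · rw [hsq]; convert div2 h7 using 1; field_simp
  · convert div2 h8 using 1; field_simp

/-! ### Energy identities in an abstract Hilbert space -/

section Calculus

variable {H : Type*} [NormedAddCommGroup H] [InnerProductSpace ℂ H]

/-- Real part of the inner product. -/
noncomputable def reInner (x y : H) : ℝ := (inner ℂ x y).re

/-- Imaginary part of the inner product. -/
noncomputable def imInner (x y : H) : ℝ := (inner ℂ x y).im

lemma reInner_comm (x y : H) : reInner x y = reInner y x := inner_re_symm (𝕜 := ℂ) x y

lemma imInner_comm (x y : H) : imInner x y = -imInner y x := inner_im_symm (𝕜 := ℂ) x y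

lemma reInner_self (x : H) : reInner x x = ‖x‖ ^ 2 := inner_self_eq_norm_sq (𝕜 := ℂ) x

lemma imInner_self (x : H) : imInner x x = 0 := inner_self_im (𝕜 := ℂ) x

lemma reInner_add_left (x y z : H) : reInner (x + y) z = reInner x z + reInner y z := by
  simp [reInner]

lemma reInner_add_right (x y z : H) : reInner x (y + z) = reInner x y + reInner x z := by
  simp [reInner]

lemma reInner_sub_left (x y z : H) : reInner (x - y) z = reInner x z - reInner y z := by
  simp [reInner]

lemma reInner_sub_right (x y z : H) : reInner x (y - z) = reInner x y - reInner x z := by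
  simp [reInner]

lemma imInner_add_left (x y z : H) : imInner (x + y) z = imInner x z + imInner y z := by
  simp [imInner]

lemma imInner_add_right (x y z : H) : imInner x (y + z) = imInner x y + imInner x z := by
  simp [imInner]

lemma imInner_sub_left (x y z : H) : imInner (x - y) z = imInner x z - imInner y z := by
  simp [imInner]

lemma imInner_sub_right (x y z : H) : imInner x (y - z) = imInner x y - imInner x z := by
  simp [imInner]

lemma reInner_smul_left (r : ℝ) (x y : H) : reInner ((r : ℂ) • x) y = r * reInner x y := by
  simp [reInner]

lemma reInner_smul_right (r : ℝ) (x y : H) : reInner x ((r : ℂ) • y) = r * reInner x y := by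
  simp [reInner]

lemma imInner_smul_left (r : ℝ) (x y : H) : imInner ((r : ℂ) • x) y = r * imInner x y := by
  simp [imInner]

lemma imInner_smul_right (r : ℝ) (x y : H) : imInner x ((r : ℂ) • y) = r * imInner x y := by
  simp [imInner]

lemma reInner_I_smul_left (x y : H) : reInner (Complex.I • x) y = imInner x y := by
  simp [reInner, imInner]

lemma imInner_I_smul_left (x y : H) : imInner (Complex.I • x) y = -reInner x y := by
  simp [reInner, imInner]

lemma abs_reInner_le (x y : H) : |reInner x y| ≤ ‖x‖ * ‖y‖ :=
  (Complex.abs_re_le_norm _).trans (norm_inner_le_norm x y)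

lemma abs_imInner_le (x y : H) : |imInner x y| ≤ ‖x‖ * ‖y‖ :=
  (Complex.abs_im_le_norm _).trans (norm_inner_le_norm x y)

/-- The calculus of `H¹(-1, 1)` inside a Hilbert space: `M` is multiplication by the variable,
`D f f'` says that `f` has derivative `f'`, and `D₀ f f'` that moreover `f` vanishes at both
ends. -/
structure IsSobolevCalculus (M : H →ₗ[ℂ] H) (D D₀ : H → H → Prop) : Prop where
  symm : ∀ x y, inner ℂ (M x) y = inner ℂ x (M y)
  norm_le : ∀ x, ‖M x‖ ≤ ‖x‖
  toD : ∀ {f f'}, D₀ f f' → D f f'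
  mul : ∀ {f f'}, D f f' → D (M f) (f + M f')
  mul₀ : ∀ {f f'}, D₀ f f' → D₀ (M f) (f + M f')
  -- Multiplication by `1 - y²` creates the boundary zeros that `φ'` lacks.
  cut : ∀ {f f'}, D f f' → D₀ (f - M (M f)) (f' - (M f + M (f + M f')))
  ibp : ∀ {f f' h h'}, D f f' → D₀ h h' → inner ℂ f' h + inner ℂ f h' = 0

namespace IsSobolevCalculus

variable {M : H →ₗ[ℂ] H} {D D₀ : H → H → Prop}

lemma reInner_mul (hM : IsSobolevCalculus M D D₀) (x y : H) : reInner (M x) y = reInner x (M y) := by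
  rw [reInner, reInner, hM.symm]

lemma imInner_mul (hM : IsSobolevCalculus M D D₀) (x y : H) : imInner (M x) y = imInner x (M y) := by
  rw [imInner, imInner, hM.symm]

lemma norm_mul_sq (hM : IsSobolevCalculus M D D₀) (x : H) : ‖M x‖ ^ 2 = reInner x (M (M x)) := by
  rw [← reInner_self, hM.reInner_mul]

lemma re_ibp (hM : IsSobolevCalculus M D D₀) {f f' h h' : H} (hf : D f f') (hh : D₀ h h') : reInner f' h + reInner f h' = 0 := by
  simpa [reInner] using congrArg Complex.re (hM.ibp hf hh)

lemma im_ibp (hM : IsSobolevCalculus M D D₀) {f f' h h' : H} (hf : D f f') (hh : D₀ h h') : imInner f' h + imInner f h' = 0 := by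
  simpa [imInner] using congrArg Complex.im (hM.ibp hf hh)

lemma norm_sub_mul_mul_le (hM : IsSobolevCalculus M D D₀) (x : H) : ‖x - M (M x)‖ ≤ ‖x‖ := by
  apply le_of_sq_le_sq _ (norm_nonneg x)
  have h : ‖x - M (M x)‖ ^ 2 = ‖x‖ ^ 2 - 2 * ‖M x‖ ^ 2 + ‖M (M x)‖ ^ 2 := by
    rw [← reInner_self, ← reInner_self (M (M x)), hM.norm_mul_sq, ← reInner_self]
    simp only [reInner_sub_left, reInner_sub_right, hM.reInner_mul]
    ring
  have := pow_le_pow_left₀ (norm_nonneg _) (hM.norm_le (M x)) 2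
  nlinarith [sq_nonneg ‖M x‖]

/-- Stream function: `⟨φ, w⟩ = -(‖φ'‖² + k²‖φ‖²)`. -/
lemma reInner_stream (hM : IsSobolevCalculus M D D₀) {κ : ℝ} {w φ φ₁ : H} (hφ : D₀ φ φ₁) (hφ₁ : D φ₁ (w + (κ : ℂ) • φ)) :
    reInner φ w = -(‖φ₁‖ ^ 2 + κ * ‖φ‖ ^ 2) := by
  have h := hM.re_ibp hφ₁ hφ
  simp only [reInner_add_left, reInner_smul_left, reInner_self] at h
  linarith [reInner_comm φ w]

lemma imInner_stream (hM : IsSobolevCalculus M D D₀) {κ : ℝ} {w φ φ₁ : H} (hφ : D₀ φ φ₁) (hφ₁ : D φ₁ (w + (κ : ℂ) • φ)) :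
    imInner φ w = 0 := by
  have h := hM.im_ibp hφ₁ hφ
  simp only [imInner_add_left, imInner_smul_left, imInner_self] at h
  linarith [imInner_comm φ w]

/-- Integrating `y (|w|²)'` by parts: `y∂ + 1/2` is antisymmetric. -/
lemma reInner_mul_deriv (hM : IsSobolevCalculus M D D₀) {w w₁ : H} (hw : D₀ w w₁) : reInner w (M w₁) = -(‖w‖ ^ 2 / 2) := by
  have h := hM.re_ibp (hM.toD hw) (hM.mul₀ hw)
  simp only [reInner_add_right, reInner_self] at h
  linarith [reInner_comm w₁ (M w), hM.reInner_mul w w₁]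

/-- The Heisenberg uncertainty inequality, by Cauchy–Schwarz applied to the previous identity. -/
lemma norm_sq_le (hM : IsSobolevCalculus M D D₀) {w w₁ : H} (hw : D₀ w w₁) : ‖w‖ ^ 2 ≤ 2 * (‖M w‖ * ‖w₁‖) := by
  have h := hM.reInner_mul_deriv hw
  linarith [(abs_le.mp (abs_reInner_le (M w) w₁)).1, hM.reInner_mul w w₁]

/-- The form `‖yw - φ'‖² + k²‖φ‖²`, which is the commutator of the Rayleigh operator with the
generator of dilations, controls the Rayleigh form. -/
lemma rayleigh_le_commutator (hM : IsSobolevCalculus M D D₀) {κ : ℝ} (hκ : 1 ≤ κ) {w φ φ₁ : H} (hφ : D₀ φ φ₁)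
    (hφ₁ : D φ₁ (w + (κ : ℂ) • φ)) :
    ‖M w‖ ^ 2 + 2 * (‖φ₁‖ ^ 2 + κ * ‖φ‖ ^ 2) ≤ 28 * (‖M w - φ₁‖ ^ 2 + κ * ‖φ‖ ^ 2) := by
  have hr : M w = (M w - φ₁) + φ₁ := by abel
  set r := M w - φ₁ with hrdef
  have hwm : ∀ x, reInner w (M x) = reInner r x + reInner φ₁ x := fun x => by
    rw [← hM.reInner_mul, hr, reInner_add_left]
  -- With `yw = r + φ'`, this and `e2` give `‖yφ'‖² + κ‖yφ‖² = (3/2)‖φ‖² - Re⟨r, yφ⟩`, which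
  -- controls `φ'` away from `y = 0`.
  have e1 := hM.re_ibp (hM.mul (hM.mul hφ₁)) hφ
  have e2 := hM.reInner_mul_deriv hφ
  -- The multiplier `(1 - y²)yφ'` recovers the full norm: with `e4`, `3‖φ'‖² = 5‖yφ'‖² - 2Re⟨r, (1 -
  -- y²)φ'⟩ + κ(‖φ‖² - 3‖yφ‖²)`.
  have e3 := hM.re_ibp hφ₁ (hM.cut (hM.mul hφ₁))
  have e4 := hM.re_ibp (hM.toD hφ) (hM.cut (hM.mul (hM.toD hφ)))
  simp only [map_add, map_smul, reInner_add_left, reInner_add_right, reInner_sub_right,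
    reInner_smul_left, reInner_smul_right, hM.reInner_mul, hwm, reInner_self] at e1 e3 e4
  have c1 : reInner φ₁ (M φ) = reInner φ (M φ₁) := by rw [reInner_comm, hM.reInner_mul]
  have c2 : reInner φ₁ (M (M (M φ))) = reInner φ (M (M (M φ₁))) := by
    rw [reInner_comm, hM.reInner_mul, hM.reInner_mul, hM.reInner_mul]
  have c3 : reInner φ₁ (M w) = reInner r φ₁ + ‖φ₁‖ ^ 2 := by
    rw [reInner_comm, hM.reInner_mul, hwm, reInner_self]
  have c4 : reInner φ₁ (M (M (M w))) = reInner r (M (M φ₁)) + reInner φ₁ (M (M φ₁)) := by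
    rw [reInner_comm, hM.reInner_mul, hM.reInner_mul, hM.reInner_mul, hwm]
  rw [← hM.norm_mul_sq] at e1
  rw [c2, c1, ← hM.norm_mul_sq] at e4
  rw [c3, c4, c1, c2, ← hM.norm_mul_sq] at e3
  rw [c1, ← hM.norm_mul_sq] at e1
  have b1 := (abs_le.mp (abs_reInner_le r (M φ))).1
  have b2 := (abs_le.mp (abs_reInner_le r (φ₁ - M (M φ₁)))).1
  rw [reInner_sub_right] at b2
  have n1 := mul_le_mul_of_nonneg_left (hM.norm_sub_mul_mul_le φ₁) (norm_nonneg r)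
  have n2 := pow_le_pow_left₀ (norm_nonneg _) (hM.norm_le φ) 2
  have n3 : ‖M w‖ ^ 2 ≤ 2 * (‖r‖ ^ 2 + ‖φ₁‖ ^ 2) := by
    have := pow_le_pow_left₀ (norm_nonneg _) (norm_add_le r φ₁) 2
    rw [← hr] at this
    linarith [sq_nonneg (‖r‖ - ‖φ₁‖)]
  have n4 : ‖φ‖ ^ 2 ≤ κ * ‖φ‖ ^ 2 := le_mul_of_one_le_left (sq_nonneg _) hκ
  have n5 : 0 ≤ κ * ‖M φ‖ ^ 2 := by positivity
  have n6 : ‖M φ₁‖ ^ 2 ≤ 2 * ‖φ‖ ^ 2 + ‖r‖ ^ 2 / 2 := by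
    linarith [sq_nonneg (‖r‖ - ‖M φ‖)]
  have n7 : ‖φ₁‖ ^ 2 ≤ 5.5 * (κ * ‖φ‖ ^ 2) + 1.75 * ‖r‖ ^ 2 := by
    have e2' := congrArg (κ * ·) e2
    have e4' := congrArg (κ * ·) e4
    beta_reduce at e2' e4'
    linarith [sq_nonneg (‖r‖ - ‖φ₁‖)]
  linarith [sq_nonneg ‖r‖, sq_nonneg ‖φ‖]

set_option maxHeartbeats 800000 in
/-- The resolvent estimate for `-ν (∂² - k²) w + i k (μ w - (y² w - 2 φ)) = F`. -/
theorem resolvent_estimate (hM : IsSobolevCalculus M D D₀) {ν k μ : ℝ} (hν : 0 < ν)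
    (hk : 1 ≤ |k|) {w w₁ w₂ φ φ₁ F : H} (hw : D₀ w w₁) (hw₁ : D w₁ w₂) (hφ : D₀ φ φ₁)
    (hφ₁ : D φ₁ (w + ((k ^ 2 : ℝ) : ℂ) • φ))
    (hF : F = ((-ν : ℝ) : ℂ) • (w₂ - ((k ^ 2 : ℝ) : ℂ) • w) +
      (k : ℂ) • Complex.I • ((μ : ℂ) • w - (M (M w) - ((2 : ℝ) : ℂ) • φ))) :
    √(ν / |k|) * ‖w‖ ≤ 1e6 * (‖F‖ / |k|) := by
  have hk0 : 0 < |k| := one_pos.trans_le hk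
  have hk2 : 1 ≤ k ^ 2 := by rw [← sq_abs]; nlinarith
  set b := M (M w) - ((2 : ℝ) : ℂ) • φ with hb
  set e := ‖φ₁‖ ^ 2 + k ^ 2 * ‖φ‖ ^ 2 with he
  set β := ‖M w‖ ^ 2 + 2 * e with hβ
  have hFre : ∀ x, reInner F x = -ν * (reInner w₂ x - k ^ 2 * reInner w x) +
      k * (μ * imInner w x - imInner b x) := fun x => by
    simp only [hF, reInner_add_left, reInner_smul_left, reInner_sub_left, reInner_I_smul_left,
      imInner_sub_left, imInner_smul_left]
  have hFim : ∀ x, imInner F x = -ν * (imInner w₂ x - k ^ 2 * imInner w x) -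
      k * (μ * reInner w x - reInner b x) := fun x => by
    simp only [hF, imInner_add_left, imInner_smul_left, imInner_sub_left, imInner_I_smul_left,
      reInner_sub_left, reInner_smul_left]
    ring
  have φw := hM.reInner_stream hφ hφ₁
  have φw' := hM.imInner_stream hφ hφ₁
  have hD := hM.toD hw
  have w₂w : reInner w₂ w = -‖w₁‖ ^ 2 := by
    linarith [hM.re_ibp hw₁ hw, reInner_self w₁]
  have w₂w' : imInner w₂ w = 0 := by
    linarith [hM.im_ibp hw₁ hw, imInner_self w₁]
  have ww₁ := hM.reInner_mul_deriv hw
  have bw : reInner b w = β := by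
    rw [hb, reInner_sub_left, hM.reInner_mul, reInner_smul_left, hM.reInner_mul,
      ← hM.norm_mul_sq, φw]
    ring
  have bw' : imInner b w = 0 := by
    rw [hb, imInner_sub_left, hM.imInner_mul, imInner_smul_left, ← imInner_self (M w), φw']
    ring
  have φ₁w₁ : reInner φ₁ w₁ = -‖w‖ ^ 2 + k ^ 2 * e := by
    have h := hM.re_ibp hφ₁ hw
    rw [reInner_add_left, reInner_smul_left, φw, reInner_self] at h
    linarith
  have φ₁w₁' : imInner φ₁ w₁ = 0 := by
    have h := hM.im_ibp hφ₁ hw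
    rw [imInner_add_left, imInner_smul_left, φw', imInner_self] at h
    linarith
  have c1 : reInner w₁ (M w) = reInner w (M w₁) := by rw [reInner_comm, hM.reInner_mul]
  -- No boundary term appears, since `b` vanishes at both ends. The term in `e` later cancels
  -- against the `φ` part of `k²β`.
  have w₂b : reInner w₂ b = -(‖M w₁‖ ^ 2 + ‖w‖ ^ 2 - 2 * k ^ 2 * e) := by
    have h1 := hM.re_ibp hw₁ (hM.mul₀ (hM.mul₀ hw))
    have h2 := hM.re_ibp hw₁ hφ
    simp only [map_add, reInner_add_right, c1, ww₁, ← hM.norm_mul_sq] at h1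
    rw [hb, reInner_sub_right, reInner_smul_right]
    linarith [reInner_comm w₁ φ₁]
  have w₂b' : imInner w₂ b = -2 * imInner w₁ (M w) := by
    have h1 := hM.im_ibp hw₁ (hM.mul₀ (hM.mul₀ hw))
    have h2 := hM.im_ibp hw₁ hφ
    simp only [map_add, imInner_add_right] at h1
    rw [hb, imInner_sub_right, imInner_smul_right]
    linarith [imInner_comm w₁ φ₁, imInner_self (M w₁), hM.imInner_mul w₁ (M w₁)]
  -- Together with `β/2` this is minus the commutator form, as expanded in `J`.
  have bw₁ : reInner b (M w₁) = -(3 / 2 * ‖M w‖ ^ 2) + 2 * reInner φ₁ (M w) - 2 * e := by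
    have h1 := hM.re_ibp hD (hM.mul₀ (hM.mul₀ (hM.mul₀ hw)))
    have h2 := hM.re_ibp (hM.toD hφ) (hM.mul₀ hw)
    have c2 : reInner w₁ (M (M (M w))) = reInner w (M (M (M w₁))) := by
      rw [reInner_comm, hM.reInner_mul, hM.reInner_mul, hM.reInner_mul]
    simp only [map_add, reInner_add_right, c2, ← hM.norm_mul_sq] at h1
    rw [reInner_add_right] at h2
    rw [hb, reInner_sub_left, reInner_smul_left, hM.reInner_mul, hM.reInner_mul]
    linarith
  have fw := hFre w
  have fw' := hFim w
  have fw₂ := hFre w₂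
  have fb := hFre b
  have fb' := hFim b
  have fMw₁ := hFim (M w₁)
  rw [w₂w, imInner_self, bw', reInner_self] at fw
  rw [w₂w', imInner_self, bw, reInner_self] at fw'
  rw [reInner_self, reInner_comm w w₂, w₂w, imInner_comm w w₂, w₂w', imInner_comm b, w₂b'] at fw₂
  rw [w₂b, imInner_comm w b, bw', imInner_self, reInner_comm w b, bw] at fb
  rw [w₂b', imInner_comm w b, bw', reInner_comm w b, bw, reInner_self] at fb'
  rw [ww₁, bw₁] at fMw₁
  have J : ‖M w - φ₁‖ ^ 2 = ‖M w‖ ^ 2 - 2 * reInner φ₁ (M w) + ‖φ₁‖ ^ 2 := by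
    rw [← reInner_self, reInner_sub_left, reInner_sub_right, reInner_sub_right, reInner_self,
      reInner_self, reInner_comm (M w) φ₁]
    ring
  have key := hM.rayleigh_le_commutator hk2 hφ hφ₁
  have a2 : imInner w₁ (M w) = -imInner (M w) w₁ := imInner_comm _ _
  have r1 := abs_reInner_le F w
  have r2 := abs_imInner_le F w
  have r3 := abs_reInner_le F w₂
  have r4 := abs_reInner_le F b
  have r5 := abs_imInner_le F b
  have r6 := abs_imInner_le F (M w₁)
  have r7 := abs_imInner_le w₂ (M w₁)
  have hε : |k| * (ν / |k|) = ν := mul_div_cancel₀ ν hk0.ne'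
  have hg : |k| * (‖F‖ / |k|) = ‖F‖ := mul_div_cancel₀ _ hk0.ne'
  have hε0 : 0 < ν / |k| := by positivity
  have hg0 : 0 ≤ ‖F‖ / |k| := by positivity
  have he0 : 0 ≤ e := by positivity
  set ε := ν / |k|
  set g := ‖F‖ / |k|
  have i1 : ν * (‖w₁‖ ^ 2 + k ^ 2 * ‖w‖ ^ 2) ≤ ‖F‖ * ‖w‖ := by
    linarith [le_abs_self (reInner F w)]
  have i3 : ν * ‖w₂‖ ^ 2 ≤ ‖F‖ * ‖w₂‖ + 2 * (|k| * (‖M w‖ * ‖w₁‖)) := by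
    have : |k * imInner w₁ (M w)| ≤ |k| * (‖M w‖ * ‖w₁‖) := by
      rw [abs_mul]
      gcongr
      rw [a2, abs_neg]
      exact abs_imInner_le _ _
    have : 0 ≤ ν * k ^ 2 * ‖w₁‖ ^ 2 := by positivity
    linarith [neg_abs_le (reInner F w₂), neg_abs_le (k * imInner w₁ (M w))]
  have i4 : ν * ‖M w₁‖ ^ 2 ≤ ‖F‖ * ‖b‖ := by
    have : 0 ≤ ν * (‖w‖ ^ 2 + k ^ 2 * ‖M w‖ ^ 2) := by positivity
    linarith [le_abs_self (reInner F b)]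
  have i5 : |k| * (‖b‖ ^ 2 - μ * β) ≤ ‖F‖ * ‖b‖ + 2 * ν * (‖w‖ * ‖M w₁‖) := by
    have h : k * (‖b‖ ^ 2 - μ * β) = imInner F b - ν * (2 * imInner w₁ (M w)) := by linarith
    have h' : |ν * (2 * imInner w₁ (M w))| ≤ 2 * ν * (‖w‖ * ‖M w₁‖) := by
      rw [abs_mul, abs_mul, abs_of_pos hν, abs_two, ← mul_assoc, mul_comm ν]
      gcongr
      rw [← hM.imInner_mul, mul_comm]
      exact abs_imInner_le _ _
    calc |k| * (‖b‖ ^ 2 - μ * β) ≤ |k| * |‖b‖ ^ 2 - μ * β| := by gcongr; exact le_abs_self _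
      _ = |imInner F b - ν * (2 * imInner w₁ (M w))| := by rw [← abs_mul, h]
      _ ≤ _ := (abs_sub _ _).trans (add_le_add r5 h')
  have i6 : |k| * |β - μ * ‖w‖ ^ 2| ≤ ‖F‖ * ‖w‖ := by
    rw [← abs_mul, show k * (β - μ * ‖w‖ ^ 2) = imInner F w by linarith]
    exact r2
  have i7 : |k| * (‖M w - φ₁‖ ^ 2 + k ^ 2 * ‖φ‖ ^ 2) ≤
      ‖F‖ * (‖M w₁‖ + ‖w‖ / 2) + ν * (‖w₂‖ * ‖M w₁‖) + ν * k ^ 2 * (‖M w‖ * ‖w₁‖) := by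
    -- Testing with `yw' + w/2`: the two contributions of `μ` cancel.
    have h : k * (‖M w - φ₁‖ ^ 2 + k ^ 2 * ‖φ‖ ^ 2) = -(imInner F (M w₁) + imInner F w / 2 +
        ν * imInner w₂ (M w₁) - ν * k ^ 2 * imInner w (M w₁)) := by
      rw [J, fMw₁, fw', hβ, he]
      ring
    rw [← abs_of_nonneg (show 0 ≤ ‖M w - φ₁‖ ^ 2 + k ^ 2 * ‖φ‖ ^ 2 by positivity), ← abs_mul, h,
      abs_neg]
    have t1 : |imInner F w / 2| ≤ ‖F‖ * ‖w‖ / 2 := by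
      rw [abs_div, abs_two]; gcongr
    have t2 : |ν * imInner w₂ (M w₁)| ≤ ν * (‖w₂‖ * ‖M w₁‖) := by
      rw [abs_mul, abs_of_pos hν]; gcongr
    have t3 : |ν * k ^ 2 * imInner w (M w₁)| ≤ ν * k ^ 2 * (‖M w‖ * ‖w₁‖) := by
      rw [abs_mul, abs_of_pos (by positivity : 0 < ν * k ^ 2), ← hM.imInner_mul]
      gcongr
      exact abs_imInner_le _ _
    linarith [abs_sub (imInner F (M w₁) + imInner F w / 2 + ν * imInner w₂ (M w₁))
      (ν * k ^ 2 * imInner w (M w₁)), abs_add_le (imInner F (M w₁) + imInner F w / 2)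
      (ν * imInner w₂ (M w₁)), abs_add_le (imInner F (M w₁)) (imInner F w / 2)]
  refine bootstrap (ε := ε) (μ := μ) (k2 := k ^ 2) (g := g) (D := ‖w₁‖) (S := ‖w₂‖)
    (X := ‖M w₁‖) (Y := ‖M w‖) (b := ‖b‖) (β := β) hε0 (norm_nonneg _) (norm_nonneg _)
    (norm_nonneg _) (norm_nonneg _) (norm_nonneg _) (norm_nonneg _) hg0 (sq_nonneg k)
    ?_ (hM.norm_sq_le hw) ?_ ?_ ?_ ?_ ?_ (by linarith)
  all_goals refine le_of_mul_le_mul_left ?_ hk0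
  · linear_combination i1 + (‖w₁‖ ^ 2 + k ^ 2 * ‖w‖ ^ 2) * hε - ‖w‖ * hg
  · linear_combination i3 + ‖w₂‖ ^ 2 * hε - ‖w₂‖ * hg
  · linear_combination i4 + ‖M w₁‖ ^ 2 * hε - ‖b‖ * hg
  · linear_combination i5 - 2 * (‖w‖ * ‖M w₁‖) * hε - ‖b‖ * hg
  · linear_combination i6 - ‖w‖ * hg
  · have := mul_le_mul_of_nonneg_left key hk0.le
    linear_combination 28 * i7 + this - 28 * (‖M w₁‖ + ‖w‖ / 2) * hg -
      28 * (‖w₂‖ * ‖M w₁‖ + k ^ 2 * (‖M w‖ * ‖w₁‖)) * hε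

end IsSobolevCalculus

end Calculus

/-! ### Absolutely continuous functions with square-integrable derivative -/

instance : IsFiniteMeasure intervalMeasure := by
  unfold intervalMeasure; infer_instance

lemma integral_intervalMeasure (f : ℝ → ℂ) : ∫ y, f y ∂intervalMeasure = ∫ y in (-1)..1, f y := by
  rw [intervalIntegral.integral_of_le (by norm_num), intervalMeasure, integral_Ioc_eq_integral_Ioo]

lemma IsL2.integrable {f : ℝ → ℂ} (hf : IsL2 f) : Integrable f intervalMeasure :=
  MemLp.integrable (q := 2) (by norm_num) hf

lemma intervalIntegrable_iff {f : ℝ → ℂ} :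
    IntervalIntegrable f volume (-1) 1 ↔ Integrable f intervalMeasure := by
  rw [intervalIntegrable_iff_integrableOn_Ioo_of_le (by norm_num)]; rfl

lemma IsL2.intervalIntegrable {f : ℝ → ℂ} (hf : IsL2 f) : IntervalIntegrable f volume (-1) 1 :=
  intervalIntegrable_iff.mpr hf.integrable

lemma ae_intervalMeasure {p : ℝ → Prop} :
    (∀ᵐ x ∂intervalMeasure, p x) ↔ ∀ᵐ x, x ∈ uIcc (-1 : ℝ) 1 → p x := by
  rw [intervalMeasure, Measure.restrict_congr_set Ioo_ae_eq_Icc,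
    ae_restrict_iff' measurableSet_Icc, uIcc_of_le (by norm_num)]

lemma isL2_of_continuousOn {f : ℝ → ℂ} (hf : ContinuousOn f (Icc (-1) 1)) : IsL2 f := by
  obtain ⟨C, hC⟩ := isCompact_Icc.exists_bound_of_continuousOn hf
  refine MemLp.of_bound ((hf.mono Ioo_subset_Icc_self).aestronglyMeasurable measurableSet_Ioo) C ?_
  filter_upwards [ae_restrict_mem measurableSet_Ioo] with x hx using hC x (Ioo_subset_Icc_self hx)

lemma IsL2.continuousOn_mul {f g : ℝ → ℂ} (hf : ContinuousOn f (Icc (-1) 1)) (hg : IsL2 g) :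
    IsL2 (fun y => f y * g y) := by
  obtain ⟨C, hC⟩ := isCompact_Icc.exists_bound_of_continuousOn hf
  refine MemLp.of_le_mul (c := C) hg ((isL2_of_continuousOn hf).1.mul hg.1) ?_
  filter_upwards [ae_restrict_mem measurableSet_Ioo] with x hx
  rw [norm_mul]
  gcongr
  exact hC x (Ioo_subset_Icc_self hx)

lemma absolutelyContinuousOnInterval_integral {f : ℝ → ℂ} {a b : ℝ}
    (hf : IntervalIntegrable f volume a b) :
    AbsolutelyContinuousOnInterval (fun x => ∫ t in a..x, f t) a b := by
  have hre : IntervalIntegrable (fun x => (f x).re) volume a b := ⟨hf.1.re, hf.2.re⟩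
  have him : IntervalIntegrable (fun x => (f x).im) volume a b := ⟨hf.1.im, hf.2.im⟩
  have h1 := (hre.absolutelyContinuousOnInterval_intervalIntegral left_mem_uIcc).smul
    (contDiffOn_const (c := (1 : ℂ))).absolutelyContinuousOnInterval
  have h2 := (him.absolutelyContinuousOnInterval_intervalIntegral left_mem_uIcc).smul
    (contDiffOn_const (c := Complex.I)).absolutelyContinuousOnInterval
  have key : ∀ x ∈ uIcc a b, (∫ t in a..x, f t) =
      (∫ t in a..x, (f t).re) • (1 : ℂ) + (∫ t in a..x, (f t).im) • Complex.I := by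
    intro x hx
    have hx' : IntervalIntegrable f volume a x := hf.mono_set (uIcc_subset_uIcc_left hx)
    have e1 := Complex.reCLM.intervalIntegral_comp_comm hx'
    have e2 := Complex.imCLM.intervalIntegral_comp_comm hx'
    simp only [Complex.reCLM_apply, Complex.imCLM_apply] at e1 e2
    rw [e1, e2]
    simp [Complex.re_add_im]
  have h := h1.add h2
  rw [absolutelyContinuousOnInterval_iff] at h ⊢
  intro ε hε
  obtain ⟨δ, hδ, H⟩ := h ε hε
  refine ⟨δ, hδ, fun E hE hlt => ?_⟩
  convert H E hE hlt using 1
  refine Finset.sum_congr rfl fun i hi => ?_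
  have := hE.1 i hi
  rw [key _ this.1, key _ this.2]
  rfl

/-- `f` is absolutely continuous on `[-1, 1]` with derivative `f' ∈ L²(I)`. -/
structure HasL2Deriv (f f' : ℝ → ℂ) : Prop where
  ac : AbsolutelyContinuousOnInterval f (-1) 1
  hasDerivAt : ∀ᵐ x ∂intervalMeasure, HasDerivAt f (f' x) x
  memL2 : IsL2 f'

namespace HasL2Deriv

variable {f f' g g' : ℝ → ℂ}

lemma continuousOn (hf : HasL2Deriv f f') : ContinuousOn f (Icc (-1) 1) := by
  simpa [uIcc_of_le] using hf.ac.continuousOn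

lemma isL2 (hf : HasL2Deriv f f') : IsL2 f := isL2_of_continuousOn hf.continuousOn

lemma congr_deriv (hf : HasL2Deriv f f') (h : f' =ᵐ[intervalMeasure] g') : HasL2Deriv f g' where
  ac := hf.ac
  hasDerivAt := by filter_upwards [hf.hasDerivAt, h] with x h1 h2 using h2 ▸ h1
  memL2 := (memLp_congr_ae h).mp hf.memL2

lemma mul (hf : HasL2Deriv f f') (hg : HasL2Deriv g g') :
    HasL2Deriv (fun y => f y * g y) (fun y => g y * f' y + f y * g' y) where
  ac := hf.ac.smul hg.ac
  hasDerivAt := by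
    filter_upwards [hf.hasDerivAt, hg.hasDerivAt] with x h1 h2
    exact (h1.fun_mul h2).congr_deriv (by ring)
  memL2 := (IsL2.continuousOn_mul hg.continuousOn hf.memL2).add
    (IsL2.continuousOn_mul hf.continuousOn hg.memL2)

lemma sub (hf : HasL2Deriv f f') (hg : HasL2Deriv g g') :
    HasL2Deriv (fun y => f y - g y) (fun y => f' y - g' y) where
  ac := hf.ac.sub hg.ac
  hasDerivAt := by
    filter_upwards [hf.hasDerivAt, hg.hasDerivAt] with x h1 h2 using h1.sub h2
  memL2 := hf.memL2.sub hg.memL2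

lemma conj (hf : HasL2Deriv f f') :
    HasL2Deriv (fun y => star (f y)) (fun y => star (f' y)) where
  ac := by
    have := hf.ac
    simp only [AbsolutelyContinuousOnInterval, dist_star_star] at this ⊢
    exact this
  hasDerivAt := by
    filter_upwards [hf.hasDerivAt] with x h1 using h1.star
  memL2 := hf.memL2.star

lemma of_contDiff {f : ℝ → ℂ} (hf : ContDiff ℝ 1 f) : HasL2Deriv f (deriv f) where
  ac := hf.contDiffOn.absolutelyContinuousOnInterval
  hasDerivAt := ae_of_all _ fun x => (hf.differentiable (by norm_num) x).hasDerivAt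
  memL2 := isL2_of_continuousOn (hf.continuous_deriv le_rfl).continuousOn

lemma primitive (hf : IsL2 f) (c : ℂ) : HasL2Deriv (fun x => c + ∫ t in (-1)..x, f t) f where
  ac := (contDiffOn_const (c := c)).absolutelyContinuousOnInterval.add
    (absolutelyContinuousOnInterval_integral hf.intervalIntegrable)
  hasDerivAt := by
    rw [ae_intervalMeasure]
    filter_upwards [hf.intervalIntegrable.ae_hasDerivAt_integral] with x h hx
    exact (h hx (-1) left_mem_uIcc).const_add c
  memL2 := hf

/-- Subtracting the primitive of `f'` leaves an absolutely continuous function with derivative zero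
almost everywhere, hence a constant. -/
lemma integral_eq (hf : HasL2Deriv f f') : ∫ y, f' y ∂intervalMeasure = f 1 - f (-1) := by
  have h := hf.sub (primitive hf.memL2 0)
  obtain ⟨C, hC⟩ := h.ac.const_of_ae_hasDerivAt_zero (by
    rw [← ae_intervalMeasure]
    filter_upwards [h.hasDerivAt] with x hx
    exact hx.congr_deriv (sub_self _))
  have h1 := hC 1 right_mem_uIcc
  have h2 := hC (-1) left_mem_uIcc
  simp only [intervalIntegral.integral_same, zero_add, sub_zero] at h1 h2
  rw [integral_intervalMeasure, h2, ← h1]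
  ring

lemma integral_mul (hf : HasL2Deriv f f') (hg : HasL2Deriv g g') (h1 : g (-1) = 0)
    (h2 : g 1 = 0) :
    ∫ y, g y * f' y ∂intervalMeasure = -∫ y, f y * g' y ∂intervalMeasure := by
  have h := (hf.mul hg).integral_eq
  rw [integral_add (IsL2.continuousOn_mul hg.continuousOn hf.memL2).integrable
    (IsL2.continuousOn_mul hf.continuousOn hg.memL2).integrable, h1, h2] at h
  simp only [mul_zero, sub_zero] at h
  exact eq_neg_of_add_eq_zero_left h

end HasL2Deriv

/-! ### Weak derivatives and continuous representatives -/

lemma IsTestFunction.apply_eq_zero {ψ : ℝ → ℝ} (hψ : IsTestFunction ψ) {x : ℝ}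
    (hx : x ∉ Ioo (-1 : ℝ) 1) : ψ x = 0 :=
  image_eq_zero_of_notMem_tsupport fun h => hx (hψ.2.2 h)

lemma IsTestFunction.integral_deriv_mul {ψ : ℝ → ℝ} (hψ : IsTestFunction ψ) {f f' : ℝ → ℂ}
    (hf : HasL2Deriv f f') :
    ∫ y, ((deriv ψ y : ℝ) : ℂ) * f y ∂intervalMeasure =
      -∫ y, (ψ y : ℂ) * f' y ∂intervalMeasure := by
  have hd : ContDiff ℝ 1 ψ := hψ.1.of_le (by norm_cast)
  have hc : HasL2Deriv (fun y => (ψ y : ℂ)) (fun y => ((deriv ψ y : ℝ) : ℂ)) := by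
    refine (HasL2Deriv.of_contDiff (Complex.ofRealCLM.contDiff.comp hd)).congr_deriv
      (ae_of_all _ fun x => ?_)
    exact ((hd.differentiable (by norm_num) x).hasDerivAt.ofReal_comp).deriv
  rw [hf.integral_mul hc (by simp [hψ.apply_eq_zero]) (by simp [hψ.apply_eq_zero]), neg_neg]
  simp_rw [mul_comm]

/-- A test function of integral zero is the derivative of a test function. -/
lemma IsTestFunction.exists_deriv_eq {η : ℝ → ℝ} (hη : IsTestFunction η)
    (h0 : ∫ y, η y ∂intervalMeasure = 0) : ∃ ψ, IsTestFunction ψ ∧ deriv ψ = η := by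
  have hcont := hη.1.continuous
  have hderiv : ∀ x, HasDerivAt (fun x => ∫ t in (-1)..x, η t) (η x) x := fun x =>
    hcont.integral_hasStrictDerivAt (-1) x |>.hasDerivAt
  have hd : deriv (fun x => ∫ t in (-1)..x, η t) = η := funext fun x => (hderiv x).deriv
  obtain ⟨a, b, ha, hb, hab⟩ : ∃ a b : ℝ, -1 < a ∧ b < 1 ∧ tsupport η ⊆ Icc a b := by
    rcases (tsupport η).eq_empty_or_nonempty with h | h
    · exact ⟨0, 0, by norm_num, by norm_num, by simp [h]⟩
    · have hK : IsCompact (tsupport η) := hη.2.1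
      obtain ⟨a, haK, ha⟩ := hK.exists_isLeast h
      obtain ⟨b, hbK, hb⟩ := hK.exists_isGreatest h
      exact ⟨a, b, (hη.2.2 haK).1, (hη.2.2 hbK).2, fun x hx => ⟨ha hx, hb hx⟩⟩
  have hz : ∀ x ∉ Icc a b, η x = 0 := fun x hx =>
    image_eq_zero_of_notMem_tsupport fun h => hx (hab h)
  -- Left of `[a, b]` the integrand vanishes; right of it the primitive equals the total integral,
  -- which is zero.
  have hsupp : Function.support (fun x => ∫ t in (-1)..x, η t) ⊆ Icc a b := by
    intro x hx
    by_contra hn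
    apply hx
    rw [mem_Icc, not_and_or, not_le, not_le] at hn
    have htot : ∫ t in (-1)..1, η t = 0 := by
      rw [← h0, intervalIntegral.integral_of_le (by norm_num), intervalMeasure,
        integral_Ioc_eq_integral_Ioo]
    have hi := fun u v => hcont.intervalIntegrable (μ := volume) u v
    rcases hn with hn | hn
    · refine (intervalIntegral.integral_congr (g := fun _ => 0) fun t ht => hz t ?_).trans (by simp)
      rw [mem_Icc, not_and_or, not_le]
      exact Or.inl (ht.2.trans_lt (max_lt ha hn))
    · change ∫ t in (-1)..x, η t = 0
      rw [← intervalIntegral.integral_add_adjacent_intervals (hi (-1) 1) (hi 1 x), htot, zero_add]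
      refine (intervalIntegral.integral_congr (g := fun _ => 0) fun t ht => hz t ?_).trans (by simp)
      rw [mem_Icc, not_and_or, not_le, not_le]
      exact Or.inr ((lt_min hb hn).trans_le ht.1)
  refine ⟨fun x => ∫ t in (-1)..x, η t, ⟨?_, ?_, ?_⟩, hd⟩
  · rw [contDiff_infty_iff_deriv, hd]
    exact ⟨fun x => (hderiv x).differentiableAt, hη.1⟩
  · exact HasCompactSupport.of_support_subset_isCompact isCompact_Icc hsupp
  · exact (closure_minimal hsupp isClosed_Icc).trans fun x hx =>
      ⟨ha.trans_le hx.1, hx.2.trans_lt hb⟩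

lemma exists_isTestFunction_integral_eq_one :
    ∃ θ, IsTestFunction θ ∧ ∫ y, θ y ∂intervalMeasure = 1 := by
  let β : ContDiffBump (0 : ℝ) := ⟨1 / 4, 1 / 2, by norm_num, by norm_num⟩
  have hs : tsupport (β.normed volume) ⊆ Ioo (-1 : ℝ) 1 := by
    rw [β.tsupport_normed_eq, Real.closedBall_eq_Icc]
    exact Icc_subset_Ioo (by norm_num [β]) (by norm_num [β])
  refine ⟨β.normed volume, ⟨β.contDiff_normed, β.hasCompactSupport_normed, hs⟩, ?_⟩
  rw [intervalMeasure, setIntegral_eq_integral_of_forall_compl_eq_zero, β.integral_normed]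
  exact fun x hx => image_eq_zero_of_notMem_tsupport fun h => hx (hs h)

lemma IsTestFunction.integrable_mul {ψ : ℝ → ℝ} (hψ : IsTestFunction ψ) {f : ℝ → ℂ}
    (hf : IsL2 f) : Integrable (fun y => (ψ y : ℂ) * f y) intervalMeasure :=
  (IsL2.continuousOn_mul (Complex.continuous_ofReal.comp hψ.1.continuous).continuousOn hf).integrable

/-- The du Bois-Reymond lemma. -/
lemma exists_ae_eq_const_of_integral_deriv_mul_eq_zero {f : ℝ → ℂ} (hf : IsL2 f)
    (h : ∀ ψ, IsTestFunction ψ → ∫ y, ((deriv ψ y : ℝ) : ℂ) * f y ∂intervalMeasure = 0) :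
    ∃ c : ℂ, f =ᵐ[intervalMeasure] fun _ => c := by
  obtain ⟨θ, hθ, hθ1⟩ := exists_isTestFunction_integral_eq_one
  set c := ∫ y, (θ y : ℂ) * f y ∂intervalMeasure with hc
  have hfc : IsL2 fun y => f y - c := hf.sub (memLp_const c)
  refine ⟨c, ?_⟩
  have key : ∀ᵐ x, x ∈ Ioo (-1 : ℝ) 1 → f x - c = 0 := by
    refine isOpen_Ioo.ae_eq_zero_of_integral_contDiff_smul_eq_zero
      (IntegrableOn.locallyIntegrableOn hfc.integrable) fun η h1 h2 h3 => ?_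
    have hη : IsTestFunction η := ⟨h1, h2, h3⟩
    have hηi : Integrable η intervalMeasure := (h1.continuous.integrable_of_hasCompactSupport h2).restrict
    have hθi : Integrable θ intervalMeasure :=
      (hθ.1.continuous.integrable_of_hasCompactSupport hθ.2.1).restrict
    set m := ∫ y, η y ∂intervalMeasure with hm
    -- Removing `m θ` makes the mean of `η` zero, so the hypothesis applies to a primitive.
    obtain ⟨ψ, hψ, hψd⟩ := IsTestFunction.exists_deriv_eq (η := fun y => η y - m * θ y)
      ⟨h1.sub (contDiff_const.mul hθ.1), h2.sub hθ.2.1.mul_left,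
        (tsupport_sub _ _).trans (union_subset h3 ((tsupport_mul_subset_right).trans hθ.2.2))⟩
      (by rw [integral_sub hηi (hθi.const_mul m), integral_const_mul, hθ1, ← hm]; ring)
    have e := h ψ hψ
    rw [hψd] at e
    have e1 : ∫ y, ((η y - m * θ y : ℝ) : ℂ) * f y ∂intervalMeasure =
        (∫ y, (η y : ℂ) * f y ∂intervalMeasure) - m * c := by
      rw [hc, ← integral_const_mul, ← integral_sub (hη.integrable_mul hf)
        ((hθ.integrable_mul hf).const_mul _)]
      congr 1; ext y; push_cast; ring
    rw [e1] at e
    have e2 : ∫ y, η y • (f y - c) = ∫ y, η y • (f y - c) ∂intervalMeasure := by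
      rw [intervalMeasure, setIntegral_eq_integral_of_forall_compl_eq_zero]
      intro x hx
      rw [hη.apply_eq_zero hx, zero_smul]
    have e3 : ∫ y, η y • (f y - c) ∂intervalMeasure =
        (∫ y, (η y : ℂ) * f y ∂intervalMeasure) - m * c := by
      have : (∫ y, (η y : ℂ) * c ∂intervalMeasure) = m * c := by
        rw [integral_mul_const]
        exact congrArg (· * c) (integral_ofReal (𝕜 := ℂ))
      rw [← this, ← integral_sub (hη.integrable_mul hf) (hη.integrable_mul (memLp_const c))]
      congr 1; ext y; simp [mul_sub]
    rw [e2, e3, e]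
  rw [← ae_restrict_iff' measurableSet_Ioo] at key
  filter_upwards [key] with x hx using sub_eq_zero.mp hx

/-- The difference of `f` and a primitive of `g` has weak derivative zero, so du Bois-Reymond makes
it constant. -/
lemma IsWeakDeriv.exists_hasL2Deriv {f g : ℝ → ℂ} (h : IsWeakDeriv f g) (hf : IsL2 f)
    (hg : IsL2 g) : ∃ u, HasL2Deriv u g ∧ u =ᵐ[intervalMeasure] f := by
  have hP := HasL2Deriv.primitive hg 0
  obtain ⟨c, hc⟩ := exists_ae_eq_const_of_integral_deriv_mul_eq_zero (hf.sub hP.isL2)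
    fun ψ hψ => by
      have hd : ContinuousOn (fun y => ((deriv ψ y : ℝ) : ℂ)) (Icc (-1) 1) :=
        (Complex.continuous_ofReal.comp (hψ.1.continuous_deriv (by simp))).continuousOn
      simp only [Pi.sub_apply, mul_sub]
      rw [integral_sub (IsL2.continuousOn_mul hd hf).integrable
        (IsL2.continuousOn_mul hd hP.isL2).integrable, h ψ hψ, hψ.integral_deriv_mul hP, sub_self]
  refine ⟨_, HasL2Deriv.primitive hg c, ?_⟩
  filter_upwards [hc] with x hx
  rw [← hx]
  simp

/-- Continuous functions on `[-1, 1]` that agree almost everywhere agree at the endpoints too, so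
the choice of representative does not matter. -/
lemma VanishesAtEnds.eq_zero {f u u' : ℝ → ℂ} (hf : VanishesAtEnds f) (hu : HasL2Deriv u u')
    (h : u =ᵐ[intervalMeasure] f) : u (-1) = 0 ∧ u 1 = 0 := by
  obtain ⟨v, hv, hvf, h1, h2⟩ := hf
  have he : v =ᵐ[volume.restrict (Icc (-1 : ℝ) 1)] u := by
    rw [← Measure.restrict_congr_set Ioo_ae_eq_Icc]
    exact hvf.trans h.symm
  have := Measure.eqOn_Icc_of_ae_eq volume (by norm_num) he hv hu.continuousOn
  rw [← this ⟨le_rfl, by norm_num⟩, ← this ⟨by norm_num, le_rfl⟩]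
  exact ⟨h1, h2⟩

/-! ### The abstract calculus realized on `L²(I)` -/

/-- The Hilbert space `L²(I)`. -/
noncomputable abbrev L2I := Lp ℂ 2 intervalMeasure

lemma hasL2Deriv_ofReal : HasL2Deriv (fun y => (y : ℂ)) (fun _ => 1) :=
  (HasL2Deriv.of_contDiff Complex.ofRealCLM.contDiff).congr_deriv
    (ae_of_all _ fun x => ((hasDerivAt_id x).ofReal_comp).deriv)

lemma IsL2.var_mul {f : ℝ → ℂ} (hf : IsL2 f) : IsL2 (fun y => (y : ℂ) * f y) :=
  IsL2.continuousOn_mul Complex.continuous_ofReal.continuousOn hf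

lemma memLp_var_mul (f : L2I) : MemLp (fun y : ℝ => (y : ℂ) * f y) 2 intervalMeasure :=
  IsL2.var_mul (Lp.memLp f)

/-- Multiplication by the variable on `L²(I)`. -/
noncomputable def varMul : L2I →ₗ[ℂ] L2I where
  toFun f := (memLp_var_mul f).toLp
  map_add' f g := by
    apply Lp.ext
    filter_upwards [(memLp_var_mul (f + g)).coeFn_toLp, (memLp_var_mul f).coeFn_toLp,
      (memLp_var_mul g).coeFn_toLp, Lp.coeFn_add f g,
      Lp.coeFn_add (memLp_var_mul f).toLp (memLp_var_mul g).toLp] with x h1 h2 h3 h4 h5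
    rw [h1, h5, Pi.add_apply, h2, h3, h4, Pi.add_apply, mul_add]
  map_smul' c f := by
    apply Lp.ext
    filter_upwards [(memLp_var_mul (c • f)).coeFn_toLp, (memLp_var_mul f).coeFn_toLp,
      Lp.coeFn_smul c f, Lp.coeFn_smul c (memLp_var_mul f).toLp] with x h1 h2 h3 h4
    rw [RingHom.id_apply, h1, h4, Pi.smul_apply, h2, h3, Pi.smul_apply, smul_eq_mul, smul_eq_mul]
    ring

lemma coeFn_varMul (f : L2I) : varMul f =ᵐ[intervalMeasure] fun y : ℝ => (y : ℂ) * f y :=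
  (memLp_var_mul f).coeFn_toLp

/-- `f ∈ H¹(I)` with derivative `f'`. -/
def HasDerivLp (f f' : L2I) : Prop :=
  ∃ u u' : ℝ → ℂ, HasL2Deriv u u' ∧ f =ᵐ[intervalMeasure] u ∧ f' =ᵐ[intervalMeasure] u'

/-- `f ∈ H¹₀(I)` with derivative `f'`. -/
def HasDerivLp₀ (f f' : L2I) : Prop :=
  ∃ u u' : ℝ → ℂ, HasL2Deriv u u' ∧ u (-1) = 0 ∧ u 1 = 0 ∧ f =ᵐ[intervalMeasure] u ∧
    f' =ᵐ[intervalMeasure] u'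

lemma isSobolevCalculus : IsSobolevCalculus varMul HasDerivLp HasDerivLp₀ where
  symm f g := by
    rw [L2.inner_def, L2.inner_def]
    apply integral_congr_ae
    filter_upwards [coeFn_varMul f, coeFn_varMul g] with x hf hg
    rw [hf, hg]
    simp only [RCLike.inner_apply, map_mul, Complex.conj_ofReal]
    ring
  norm_le f := by
    apply Lp.norm_le_norm_of_ae_le
    filter_upwards [coeFn_varMul f, ae_restrict_mem measurableSet_Ioo] with x hf hx
    rw [hf, norm_mul, Complex.norm_real, Real.norm_eq_abs]
    exact mul_le_of_le_one_left (norm_nonneg _) (abs_le.mpr ⟨hx.1.le, hx.2.le⟩)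
  toD := fun ⟨u, u', h, _, _, h1, h2⟩ => ⟨u, u', h, h1, h2⟩
  mul := fun {f f'} ⟨u, u', h, h1, h2⟩ => by
    refine ⟨_, _, hasL2Deriv_ofReal.mul h, ?_, ?_⟩
    · filter_upwards [coeFn_varMul f, h1] with x e1 e2
      rw [e1, e2]
    · filter_upwards [Lp.coeFn_add f (varMul f'), coeFn_varMul f', h1, h2] with x e0 e1 e2 e3
      rw [e0, Pi.add_apply, e1, e2, e3, mul_one]
  mul₀ := fun {f f'} ⟨u, u', h, ha, hb, h1, h2⟩ => by
    refine ⟨_, _, hasL2Deriv_ofReal.mul h, by simp [ha], by simp [hb], ?_, ?_⟩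
    · filter_upwards [coeFn_varMul f, h1] with x e1 e2
      rw [e1, e2]
    · filter_upwards [Lp.coeFn_add f (varMul f'), coeFn_varMul f', h1, h2] with x e0 e1 e2 e3
      rw [e0, Pi.add_apply, e1, e2, e3, mul_one]
  cut := fun {f f'} ⟨u, u', h, h1, h2⟩ => by
    have hm := hasL2Deriv_ofReal.mul h
    refine ⟨_, _, h.sub (hasL2Deriv_ofReal.mul hm), by simp, by simp, ?_, ?_⟩
    · filter_upwards [coeFn_varMul f, coeFn_varMul (varMul f), h1,
        Lp.coeFn_sub f (varMul (varMul f))] with x e1 e2 e3 e4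
      rw [e4, Pi.sub_apply, e2, e1, e3]
    · filter_upwards [coeFn_varMul f, coeFn_varMul f', coeFn_varMul (f + varMul f'), h1, h2,
        Lp.coeFn_sub f' (varMul f + varMul (f + varMul f')),
        Lp.coeFn_add (varMul f) (varMul (f + varMul f')), Lp.coeFn_add f (varMul f')]
        with x e1 e2 e3 e4 e5 e6 e7 e8
      rw [e6, Pi.sub_apply, e7, Pi.add_apply, e3, e8, Pi.add_apply, e1, e2, e4, e5]
      ring
  ibp := fun {f f' h h'} ⟨u, u', hu, hf, hf'⟩ ⟨v, v', hv, ha, hb, hh, hh'⟩ => by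
    -- The inner product is conjugate-linear in its first slot, so the conjugate of `u` is what gets
    -- integrated by parts.
    have e := hu.conj.integral_mul hv ha hb
    have e1 : inner ℂ f' h = ∫ y, v y * star (u' y) ∂intervalMeasure := by
      rw [L2.inner_def]
      apply integral_congr_ae
      filter_upwards [hf', hh] with x h1 h2
      rw [h1, h2]
      rfl
    have e2 : inner ℂ f h' = ∫ y, star (u y) * v' y ∂intervalMeasure := by
      rw [L2.inner_def]
      apply integral_congr_ae
      filter_upwards [hf, hh'] with x h1 h2
      rw [h1, h2, mul_comm]
      rfl
    rw [e1, e2, e, neg_add_cancel]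

/-! ### Transfer to the Orr–Sommerfeld equation -/

lemma norm_toLp_eq {f : ℝ → ℂ} (hf : IsL2 f) : ‖MemLp.toLp f hf‖ = normL2 f :=
  Lp.norm_toLp f hf

/-- The representatives of `f` and `f₁` are found separately; the derivative of the first is then
replaced by the representative `u₁`, with which it agrees almost everywhere. -/
lemma IsH2With.exists_hasL2Deriv {f f₁ f₂ : ℝ → ℂ} (h : IsH2With f f₁ f₂) :
    ∃ u u₁, HasL2Deriv u u₁ ∧ HasL2Deriv u₁ f₂ ∧ u =ᵐ[intervalMeasure] f := by
  obtain ⟨u₁, h₁, e₁⟩ := h.weakDeriv_two.exists_hasL2Deriv h.memL2_one h.memL2_two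
  obtain ⟨u, hu, e⟩ := h.weakDeriv_one.exists_hasL2Deriv h.memL2 h.memL2_one
  exact ⟨u, u₁, hu.congr_deriv e₁.symm, h₁, e⟩

lemma IsSolution.le {ν k lam : ℝ} (hν : 0 < ν) (hk : 1 ≤ |k|) {F w φ : ℝ → ℂ} (hF : IsL2 F)
    (h : IsSolution ν k lam F w φ) : √(ν / |k|) * normL2 w ≤ 1e6 * (normL2 F / |k|) := by
  obtain ⟨hw0, ⟨hφ0, φ₁, φ₂, hφ, hstream⟩, w₁, w₂, hw, heq⟩ := h
  obtain ⟨u, u₁, hu, hu₁, eu⟩ := hw.exists_hasL2Deriv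
  obtain ⟨v, v₁, hv, hv₁, ev⟩ := hφ.exists_hasL2Deriv
  obtain ⟨ua, ub⟩ := hw0.eq_zero hu eu
  obtain ⟨va, vb⟩ := hφ0.eq_zero hv ev
  rw [← norm_toLp_eq hw.memL2, ← norm_toLp_eq hF]
  have cw := MemLp.coeFn_toLp hw.memL2
  have cw₂ := MemLp.coeFn_toLp hw.memL2_two
  have cφ := MemLp.coeFn_toLp hφ.memL2
  have cF := MemLp.coeFn_toLp hF
  set W : L2I := MemLp.toLp w hw.memL2
  set W₂ : L2I := MemLp.toLp w₂ hw.memL2_two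
  set Φ : L2I := MemLp.toLp φ hφ.memL2
  -- `μ = 1 - lam` because `(1 - y² - lam)w + 2φ = μw - (y²w - 2φ)`.
  refine isSobolevCalculus.resolvent_estimate (μ := 1 - lam) hν hk (w := W)
    (w₁ := MemLp.toLp u₁ hu.memL2) (w₂ := W₂) (φ := Φ) (φ₁ := MemLp.toLp v₁ hv.memL2)
    ⟨u, u₁, hu, ua, ub, cw.trans eu.symm, MemLp.coeFn_toLp _⟩
    ⟨u₁, w₂, hu₁, MemLp.coeFn_toLp _, cw₂⟩
    ⟨v, v₁, hv, va, vb, cφ.trans ev.symm, MemLp.coeFn_toLp _⟩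
    ⟨v₁, φ₂, hv₁, MemLp.coeFn_toLp _, ?_⟩ ?_
  · filter_upwards [cw, cφ, hstream, Lp.coeFn_add W (((k ^ 2 : ℝ) : ℂ) • Φ),
      Lp.coeFn_smul ((k ^ 2 : ℝ) : ℂ) Φ] with x e1 e2 e3 e4 e5
    rw [e4, Pi.add_apply, e5, Pi.smul_apply, e1, e2, ← e3, smul_eq_mul]
    push_cast
    ring
  · apply Lp.ext
    set A : L2I := W₂ - ((k ^ 2 : ℝ) : ℂ) • W with hA
    set B : L2I := varMul (varMul W) - ((2 : ℝ) : ℂ) • Φ with hB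
    set E : L2I := (((1 - lam : ℝ) : ℂ) • W - B) with hE
    filter_upwards [cF, cw, cw₂, cφ, heq, Lp.coeFn_sub W₂ (((k ^ 2 : ℝ) : ℂ) • W),
      Lp.coeFn_smul ((k ^ 2 : ℝ) : ℂ) W, Lp.coeFn_sub (varMul (varMul W)) (((2 : ℝ) : ℂ) • Φ),
      Lp.coeFn_smul ((2 : ℝ) : ℂ) Φ, coeFn_varMul W, coeFn_varMul (varMul W),
      Lp.coeFn_sub (((1 - lam : ℝ) : ℂ) • W) B, Lp.coeFn_smul ((1 - lam : ℝ) : ℂ) W,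
      Lp.coeFn_add (((-ν : ℝ) : ℂ) • A) ((k : ℂ) • Complex.I • E), Lp.coeFn_smul ((-ν : ℝ) : ℂ) A,
      Lp.coeFn_smul (k : ℂ) (Complex.I • E), Lp.coeFn_smul Complex.I E]
      with x eF ew ew₂ eφ e a1 a2 a3 a4 a5 a6 a7 a8 a9 a10 a11 a12
    rw [eF, ← e, a9, Pi.add_apply, a10, a11, Pi.smul_apply, Pi.smul_apply, a12, Pi.smul_apply,
      hE, a7, Pi.sub_apply, a8, hB, a3, Pi.sub_apply, a4, a6, a5, hA, a1, Pi.sub_apply, a2]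
    simp only [Pi.smul_apply, smul_eq_mul, ew, ew₂, eφ]
    push_cast
    ring

end OrrSommerfeld

theorem proposition3p1 :
    ∃ C : ℝ, 0 < C ∧
      ∀ (ν k lam : ℝ), 0 < ν → 1 ≤ |k| →
        ∀ (F w φ : ℝ → ℂ), OrrSommerfeld.IsL2 F → OrrSommerfeld.IsSolution ν k lam F w φ →
          ν ^ (1 / 2 : ℝ) * |k| ^ (1 / 2 : ℝ) * OrrSommerfeld.normL2 w ≤
            C * OrrSommerfeld.normL2 F := by
  refine ⟨1e6, by norm_num, fun ν k lam hν hk F w φ hF h => ?_⟩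
  have hk0 : 0 < |k| := one_pos.trans_le hk
  have key := mul_le_mul_of_nonneg_left (h.le hν hk hF) hk0.le
  rw [← Real.sqrt_eq_rpow, ← Real.sqrt_eq_rpow]
  have e : √ν * √|k| = |k| * √(ν / |k|) := by
    rw [Real.sqrt_div hν.le]
    field_simp
    rw [Real.sq_sqrt hk0.le]
  rw [e, mul_assoc]
  refine key.trans_eq ?_
  field_simp
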